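/- Let $n\ge 2$. An $n$-Lie algebra is a finite-dimensional complex vector space $\mathfrak g$ with a skew-symmetric $n$-linear bracket satisfying $$[[x_1,\dots,x_n],y_2,\dots,y_n]=\sum_{i=1}^n[x_1,\dots,[x_i,y_2,\dots,y_n],\dots,x_n].$$ A metric on $\mathfrak g$ is a nondegenerate symmetric bilinear form $B$ with $$B([x_1,\dots,x_{n-1},y_1],y_2)=-B([x_1,\dots,x_{n-1},y_2],y_1),$$ and $(\mathfrak g,B)$ is then called a metric $n$-Lie algebra. A subspace $I\subseteq\mathfrak g$ is an ideal if $[I,\mathfrak g,\dots,\mathfrak g]\subseteq I$. Put $W^\perp=\{x\in\mathfrak g: B(w,x)=0\ \text{for all } w\in W\}$; a subspace $W$ is nondegenerate if $W\cap W^\perp=0$ and isotropic if $W\subseteq W^\perp$. The pair $(\mathfrak g,B)$ is indecomposable if $\mathfrak g$ is not the direct sum of two nonzero nondegenerate ideals. An ideal is isomaximal if it is isotropic and is not properly contained in any isotropic ideal. The center is $C(\mathfrak g)=\{x\in\mathfrak g:[x,\mathfrak g,\dots,\mathfrak g]=0\}$. Put $\mathfrak g^{(0)}=\mathfrak g$ and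 $\mathfrak g^{(s+1)}=[\mathfrak g^{(s)},\dots,\mathfrak g^{(s)}]$ (the linear span of all brackets of $n$ elements of $\mathfrak g^{(s)}$) for $s\ge 0$; $\mathfrak g$ is solvable if $\mathfrak g^{(r)}=0$ for some $r\ge 0$. Let $(\mathfrak g,B)$ be an indecomposable metric $n$-Lie algebra whose center $C(\mathfrak g)$ is nonzero and is an isomaximal ideal. Then $\mathfrak g$ is solvable. -/

import Mathlib

/-- An `n`-Lie algebra structure (Filippov) on a complex vector space `g`. Skew-symmetry
(`[x₁, …, xₙ] = sign σ • [x_{σ 1}, …, x_{σ n}]`, which over `ℂ` is the same as being alternating)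
is contained in the type of `bracket`.
The fundamental identity
`[[x₁, …, xₙ], y₂, …, yₙ] = ∑ i, [x₁, …, [xᵢ, y₂, …, yₙ], …, xₙ]`
is stated with the distinguished slot `j` arbitrary instead of the first one: exchanging slot `j`
and the first slot changes the sign of both sides. The entry `y j` is overwritten. -/
structure NLieAlgebra (n : ℕ) (g : Type*) [AddCommGroup g] [Module ℂ g] where
  /-- The `n`-ary bracket `[x₁, …, xₙ]`. -/
  bracket : g [⋀^Fin n]→ₗ[ℂ] g
  fundamental_identity : ∀ (x y : Fin n → g) (j : Fin n),
    bracket (Function.update y j (bracket x)) =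
      ∑ i, bracket (Function.update x i (bracket (Function.update y j (x i))))

namespace NLieAlgebra

variable {n : ℕ} {g : Type*} [AddCommGroup g] [Module ℂ g]

/-- `I` is an ideal: `[I, g, …, g] ⊆ I` (by skew-symmetry the slot is immaterial). -/
def IsIdeal (L : NLieAlgebra n g) (I : Submodule ℂ g) : Prop :=
  ∀ (v : Fin n → g) (i : Fin n), v i ∈ I → L.bracket v ∈ I

/-- The center `{x | [x, g, …, g] = 0}` (by skew-symmetry the slot is immaterial). -/
def center (L : NLieAlgebra n g) : Submodule ℂ g where
  carrier := {x | ∀ (v : Fin n → g) (i : Fin n), L.bracket (Function.update v i x) = 0}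
  zero_mem' := fun v i => L.bracket.map_update_zero v i
  add_mem' := fun {a b} ha hb v i => by
    rw [L.bracket.map_update_add, ha v i, hb v i, add_zero]
  smul_mem' := fun c x hx v i => by
    rw [L.bracket.map_update_smul, hx v i, smul_zero]

/-- The subspace `[W, …, W]` spanned by all brackets of `n` elements of `W`. -/
def bracketSpan (L : NLieAlgebra n g) (W : Submodule ℂ g) : Submodule ℂ g :=
  Submodule.span ℂ {z | ∃ v : Fin n → g, (∀ i, v i ∈ W) ∧ L.bracket v = z}

/-- The derived series `I⁽⁰⁾ = I`, `I⁽ˢ⁺¹⁾ = [I⁽ˢ⁾, …, I⁽ˢ⁾]`. -/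
def derivedSeries (L : NLieAlgebra n g) (I : Submodule ℂ g) : ℕ → Submodule ℂ g
  | 0 => I
  | s + 1 => L.bracketSpan (L.derivedSeries I s)

/-- `I` is a solvable ideal. -/
def IsSolvableIdeal (L : NLieAlgebra n g) (I : Submodule ℂ g) : Prop :=
  L.IsIdeal I ∧ ∃ r : ℕ, L.derivedSeries I r = ⊥

/-- The `n`-Lie algebra is solvable, that is, `g` is a solvable ideal of itself. -/
def IsSolvable (L : NLieAlgebra n g) : Prop :=
  L.IsSolvableIdeal ⊤

end NLieAlgebra

/-- A metric `n`-Lie algebra: an `n`-Lie algebra with a nondegenerate symmetric bilinear form `B`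
such that `B ([x₁, …, xₙ₋₁, y₁], y₂) = - B ([x₁, …, xₙ₋₁, y₂], y₁)`. The invariance is stated with
the varying slot `i` arbitrary instead of the last one, which is equivalent by skew-symmetry;
the entry `x i` is overwritten. -/
structure MetricNLieAlgebra (n : ℕ) (g : Type*) [AddCommGroup g] [Module ℂ g] extends
    NLieAlgebra n g where
  /-- The metric. -/
  B : LinearMap.BilinForm ℂ g
  symm : ∀ x y, B x y = B y x
  nondegenerate : ∀ x, (∀ y, B x y = 0) → x = 0
  invariant : ∀ (x : Fin n → g) (i : Fin n) (y₁ y₂ : g),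
    B (bracket (Function.update x i y₁)) y₂ = -B (bracket (Function.update x i y₂)) y₁

namespace MetricNLieAlgebra

variable {n : ℕ} {g : Type*} [AddCommGroup g] [Module ℂ g]

/-- The orthogonal complement `{x | B w x = 0 for all w ∈ W}`. -/
def orthogonal (M : MetricNLieAlgebra n g) (W : Submodule ℂ g) : Submodule ℂ g :=
  LinearMap.BilinForm.orthogonal M.B W

/-- `W` is nondegenerate: `W ∩ W^⊥ = 0`. -/
def IsNondegenerate (M : MetricNLieAlgebra n g) (W : Submodule ℂ g) : Prop :=
  W ⊓ M.orthogonal W = ⊥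

/-- `W` is isotropic: `W ⊆ W^⊥`. -/
def IsIsotropic (M : MetricNLieAlgebra n g) (W : Submodule ℂ g) : Prop :=
  W ≤ M.orthogonal W

/-- `I` is an isotropic ideal. -/
def IsIsotropicIdeal (M : MetricNLieAlgebra n g) (I : Submodule ℂ g) : Prop :=
  M.IsIdeal I ∧ M.IsIsotropic I

/-- `I` is an isomaximal ideal: an isotropic ideal that is not properly contained in any
isotropic ideal. -/
def IsIsomaximal (M : MetricNLieAlgebra n g) (I : Submodule ℂ g) : Prop :=
  Maximal M.IsIsotropicIdeal I

/-- The metric `n`-Lie algebra is the direct sum of two nonzero nondegenerate ideals. -/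
def IsDecomposable (M : MetricNLieAlgebra n g) : Prop :=
  ∃ I J : Submodule ℂ g, M.IsIdeal I ∧ M.IsIdeal J ∧ M.IsNondegenerate I ∧ M.IsNondegenerate J ∧
    I ≠ ⊥ ∧ J ≠ ⊥ ∧ IsCompl I J

/-- Not decomposable. -/
def IsIndecomposable (M : MetricNLieAlgebra n g) : Prop :=
  ¬M.IsDecomposable

end MetricNLieAlgebra

/-! Let `Z` be the center and let `P` be the perfect ideal at which the derived series stabilizes.
Suppose `P ≠ 0`. Invariance of `B` gives `P ⊆ Z^⊥`, so an ideal contained in `P` on which `B`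
vanishes lies in `Z`, because its sum with `Z` is again isotropic.

Let `D` be the Lie algebra of endomorphisms of `P` induced by the inner derivations of `g`; its
invariants in `P` are `P ∩ Z`. Since every isotropic submodule of `P` lies in `P ∩ Z`, orthogonal
complements make `P / (P ∩ Z)` completely reducible. A derivation mapping `P` into `Z` kills all
brackets of elements of `P`, hence `P` itself, so `D` acts faithfully on this quotient. By Lie's
theorem the radical of `D` is central. It is then zero: a derivation `f` commuting with the inner
derivations satisfies `f [x₁, …, xₙ] = n • f [x₁, …, xₙ]` on `P`, hence vanishes on `P`.

By Cartan's criterion the trace form of `D` on `P` is nondegenerate. Its Casimir endomorphism has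
trace `dim D ≠ 0`, hence a nonzero eigenvalue, and the eigenspace is a nonzero ideal `J` of `g` with
`J ∩ Z = 0`. Now `J ∩ J^⊥` is isotropic, so it lies in `J ∩ Z = 0`. Thus `J` is nondegenerate and
indecomposability forces `J = g`, contradicting `Z ≠ 0`.
-/

attribute [local instance] LieRing.ofAssociativeRing

section LieModules

open LieModule LieAlgebra Module

section CartanCriterion

variable {K L V : Type*} [Field K] [LieRing L] [LieAlgebra K L]
  [AddCommGroup V] [Module K V] [LieRingModule L V] [LieModule K L V]

lemma isNilpotent_ad_of_isNilpotent_toEnd [IsFaithful K L V] {x : L}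
    (hx : _root_.IsNilpotent (toEnd K L V x)) : _root_.IsNilpotent (ad K L x) := by
  obtain ⟨k, hk⟩ := ad_nilpotent_of_nilpotent (R := K) hx
  have intertwine : ad K (End K V) (toEnd K L V x) ∘ₗ (toEnd K L V : L →ₗ[K] End K V) =
      (toEnd K L V : L →ₗ[K] End K V) ∘ₗ ad K L x :=
    LinearMap.ext fun y ↦ ((toEnd K L V).map_lie x y).symm
  have intertwine_pow := Module.End.commute_pow_left_of_commute intertwine k
  refine ⟨k, LinearMap.ext fun y ↦ IsFaithful.injective_toEnd (R := K) (M := V) ?_⟩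
  rw [hk, LinearMap.zero_comp] at intertwine_pow
  simpa using (LinearMap.congr_fun intertwine_pow y).symm

variable [CharZero K] [Module.Finite K L] [Module.Finite K V]

variable (K V) in
theorem isSolvable_of_traceForm_eq_zero [IsFaithful K L V] (h : traceForm K L V = 0) :
    LieAlgebra.IsSolvable L := by
  let D := derivedSeries K L 1
  have nilpotent_on_V : LieModule.IsNilpotent D V :=
    isNilpotent_derivedSeries_of_traceForm_eq_zero h
  have nilpotent : LieRing.IsNilpotent D := by
    rw [LieAlgebra.isNilpotent_iff_forall (R := K)]
    exact fun d ↦ LieSubalgebra.isNilpotent_ad_of_isNilpotent_ad (D : LieSubalgebra K L) (x := d)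
      (isNilpotent_ad_of_isNilpotent_toEnd (V := V)
        ((LieModule.isNilpotent_iff_forall' (R := K)).mp nilpotent_on_V d))
  obtain ⟨k, hk⟩ := LieAlgebra.IsSolvable.solvable K D
  rw [LieIdeal.derivedSeries_eq_bot_iff] at hk
  refine LieAlgebra.IsSolvable.mk (R := K) (k := k + 1) ?_
  rwa [derivedSeries_def, derivedSeriesOfIdeal_add]

variable (K L V) in
theorem traceForm_nondegenerate_of_hasTrivialRadical [HasTrivialRadical K L] [IsFaithful K L V] :
    (traceForm K L V).Nondegenerate := by
  let I : LieIdeal K L :=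
    InvariantForm.orthogonal (traceForm K L V) (traceForm_lieInvariant K L V) ⊤
  have traceForm_eq_zero_of_mem {x : L} (hx : x ∈ I) (y : L) : traceForm K L V x y = 0 := by
    rw [traceForm_comm]
    exact hx y trivial
  have : IsFaithful K I V := inferInstanceAs (IsFaithful K (I : LieSubalgebra K L) V)
  have : LieAlgebra.IsSolvable I := isSolvable_of_traceForm_eq_zero K V
    (LinearMap.ext₂ fun x y ↦ traceForm_eq_zero_of_mem x.2 y)
  have I_eq_bot : I = ⊥ := by
    rwa [eq_bot_iff, ← HasTrivialRadical.radical_eq_bot (R := K) (L := L),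
      ← LieIdeal.solvable_iff_le_radical]
  refine (traceForm_isSymm K L V).isRefl.nondegenerate_iff_separatingLeft.mpr fun x hx ↦ ?_
  have : x ∈ I := fun y _ ↦ by rw [← hx y, traceForm_comm]
  simpa [I_eq_bot] using this

end CartanCriterion

section CentralRadical

variable {K L W : Type*} [Field K] [IsAlgClosed K] [CharZero K] [LieRing L] [LieAlgebra K L]
  [AddCommGroup W] [Module K W] [LieRingModule L W] [LieModule K L W] [Module.Finite K W]

lemma exists_ne_zero_forall_mem_lie_eq_zero [Nontrivial W] (A : LieIdeal K L)
    [LieAlgebra.IsSolvable A] : ∃ w : W, w ≠ 0 ∧ ∀ x ∈ ⁅(⊤ : LieIdeal K L), A⁆, ⁅x, w⁆ = 0 := by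
  obtain ⟨χ, hχ⟩ := exists_nontrivial_weightSpace_of_isSolvable K A W
  let U : LieSubmodule K L W := weightSpaceOfIsLieTower K W χ
  have lie_eq_smul {a : L} (ha : a ∈ A) {u : W} (hu : u ∈ U) : ⁅a, u⁆ = χ ⟨a, ha⟩ • u :=
    (mem_weightSpace χ u).mp hu ⟨a, ha⟩
  have lie_le_ker : ⁅(⊤ : LieIdeal K L), A⁆ ≤ LieModule.ker K L U := by
    refine (LieSubmodule.lie_le_iff _ _ _).mpr fun x _ a ha ↦ ?_
    refine (LieModule.mem_ker K L U _).mpr fun u ↦ Subtype.ext ?_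
    change ⁅⁅x, a⁆, (u : W)⁆ = 0
    rw [lie_lie, lie_eq_smul ha u.2, lie_eq_smul ha (U.lie_mem u.2), lie_smul, sub_self]
  have : Nontrivial U := hχ
  obtain ⟨u, hu⟩ := exists_ne (0 : U)
  exact ⟨u, by simpa using hu, fun x hx ↦
    congrArg Subtype.val ((LieModule.mem_ker K L U _).mp (lie_le_ker hx) u)⟩

variable [ComplementedLattice (LieSubmodule K L W)]

lemma lie_top_le_ker_of_isSolvable (A : LieIdeal K L) [LieAlgebra.IsSolvable A] :
    ⁅(⊤ : LieIdeal K L), A⁆ ≤ LieModule.ker K L W := by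
  let I : LieSubmodule K L W :=
    weightSpaceOfIsLieTower K W (0 : (⁅(⊤ : LieIdeal K L), A⁆ : LieIdeal K L) → K)
  have mem_I {w : W} : w ∈ I ↔ ∀ x ∈ ⁅(⊤ : LieIdeal K L), A⁆, ⁅x, w⁆ = 0 := by
    refine (mem_weightSpace _ w).trans ⟨fun h x hx ↦ ?_, fun h x ↦ ?_⟩
    · exact (h ⟨x, hx⟩).trans (zero_smul K w)
    · exact (h x x.2).trans (zero_smul K w).symm
  obtain ⟨J, hIJ⟩ := exists_isCompl I
  have hJ : J = ⊥ := by
    by_contra hJ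
    have := (LieSubmodule.nontrivial_iff_ne_bot K L W).mpr hJ
    obtain ⟨w, hw, hAw⟩ := exists_ne_zero_forall_mem_lie_eq_zero (W := J) A
    have hwI : (w : W) ∈ I := mem_I.mpr fun x hx ↦ congrArg Subtype.val (hAw x hx)
    exact hw (by simpa [hIJ.inf_eq_bot] using (LieSubmodule.mem_inf _ _ _).mpr ⟨hwI, w.2⟩)
  have hI : I = ⊤ := by simpa [hJ] using hIJ.sup_eq_top
  exact fun x hx ↦ (LieModule.mem_ker K L W _).mpr fun w ↦
    mem_I.mp (hI ▸ LieSubmodule.mem_top w) x hx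

variable (K L W) in
lemma hasCentralRadical_of_complementedLattice [Module.Finite K L] [IsFaithful K L W] :
    HasCentralRadical K L := by
  refine hasCentralRadical_of_radical_le K L fun a ha ↦ ?_
  refine (mem_maxTrivSubmodule K L L a).mpr fun x ↦ ?_
  have := lie_top_le_ker_of_isSolvable (W := W) (radical K L)
    (LieSubmodule.lie_mem_lie (LieSubmodule.mem_top x) ha)
  simpa using this

end CentralRadical

section Semisimple

variable {K L V : Type*} [Field K] [LieRing L] [AddCommGroup V] [Module K V]
  [LieRingModule L V] [Module.Finite K V] {Φ : LinearMap.BilinForm K V}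

lemma complementedLattice_of_isotropic_eq_bot (hrefl : Φ.IsRefl) (hinv : Φ.lieInvariant L)
    (hiso : ∀ I : LieSubmodule K L V, (∀ v ∈ I, ∀ w ∈ I, Φ v w = 0) → I = ⊥) :
    ComplementedLattice (LieSubmodule K L V) where
  exists_isCompl I := by
    let I' := InvariantForm.orthogonal Φ hinv I
    have isotropic : ∀ v ∈ I ⊓ I', ∀ w ∈ I ⊓ I', Φ v w = 0 := fun v hv w hw ↦ hw.2 v hv.1
    refine ⟨I', LieSubmodule.isCompl_toSubmodule.mp
      ((LinearMap.BilinForm.isCompl_orthogonal_iff_disjoint hrefl).mpr ?_)⟩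
    exact LieSubmodule.disjoint_toSubmodule.mpr (disjoint_iff.mpr (hiso _ isotropic))

variable [LieAlgebra K L] [LieModule K L V]

lemma complementedLattice_quotient_of_isotropic_le (hrefl : Φ.IsRefl) (hinv : Φ.lieInvariant L)
    {N : LieSubmodule K L V} (hN : N.toSubmodule ≤ LinearMap.ker Φ)
    (hiso : ∀ I : LieSubmodule K L V, (∀ v ∈ I, ∀ w ∈ I, Φ v w = 0) → I ≤ N) :
    ComplementedLattice (LieSubmodule K L (V ⧸ N)) := by
  let π : V →ₗ⁅K,L⁆ V ⧸ N := LieSubmodule.Quotient.mk' N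
  have π_surjective : Function.Surjective π := LieSubmodule.Quotient.surjective_mk' N
  let Ψ : LinearMap.BilinForm K (V ⧸ N) := hrefl.liftQ₂ Φ N.toSubmodule hN
  refine complementedLattice_of_isotropic_eq_bot (Φ := Ψ) ?_ ?_ fun I hI ↦ ?_
  · exact π_surjective.forall₂.mpr hrefl
  · exact fun x ↦ π_surjective.forall₂.mpr (hinv x)
  · have comap_le : I.comap π ≤ N := hiso _ fun v hv w hw ↦ hI _ hv _ hw
    refine (LieSubmodule.eq_bot_iff I).mpr (π_surjective.forall.mpr fun v hv ↦ ?_)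
    exact (LieSubmodule.Quotient.mk_eq_zero N).mpr (comap_le hv)

end Semisimple

section Casimir

variable {K L : Type*} (V : Type*) [Field K] [LieRing L] [LieAlgebra K L] [AddCommGroup V]
  [Module K V] [LieRingModule L V] [LieModule K L V] {Φ : LinearMap.BilinForm K L}

lemma sum_apply_smul_of_dualBasis {ι : Type*} [Fintype ι] [DecidableEq ι]
    (hΦ : Φ.Nondegenerate) (b : Basis ι K L) (x : L) :
    ∑ i, Φ (Φ.dualBasis hΦ b i) x • b i = x := by
  conv_rhs => rw [← b.sum_repr x]
  refine Finset.sum_congr rfl fun i _ ↦ congrArg (· • b i) ?_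
  conv_lhs => rw [← b.sum_repr x]
  simp [LinearMap.BilinForm.apply_dualBasis_left, -Basis.sum_repr]

lemma sum_lie_lie_dualBasis {ι : Type*} [Fintype ι] [DecidableEq ι] (hΦ : Φ.Nondegenerate)
    (hinv : Φ.lieInvariant L) (b : Basis ι K L) (x : L) (v : V) :
    ∑ i, ⁅⁅x, b i⁆, ⁅Φ.dualBasis hΦ b i, v⁆⁆ = -∑ i, ⁅b i, ⁅⁅x, Φ.dualBasis hΦ b i⁆, v⁆⁆ := by
  set b' := Φ.dualBasis hΦ b
  calc ∑ i, ⁅⁅x, b i⁆, ⁅b' i, v⁆⁆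
      = ∑ i, ∑ j, Φ (b' j) ⁅x, b i⁆ • ⁅b j, ⁅b' i, v⁆⁆ := by
        refine Finset.sum_congr rfl fun i _ ↦ ?_
        conv_lhs => rw [← sum_apply_smul_of_dualBasis hΦ b ⁅x, b i⁆]
        simp only [sum_lie, smul_lie, b']
    _ = -∑ i, ∑ j, Φ ⁅x, b' i⁆ (b j) • ⁅b i, ⁅b' j, v⁆⁆ := by
        rw [Finset.sum_comm, ← Finset.sum_neg_distrib]
        simp only [hinv x, neg_smul, Finset.sum_neg_distrib, neg_neg]
    _ = -∑ i, ⁅b i, ⁅⁅x, b' i⁆, v⁆⁆ := by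
        refine congrArg _ (Finset.sum_congr rfl fun i _ ↦ ?_)
        conv_rhs => rw [← b'.sum_repr ⁅x, b' i⁆]
        simp only [b', LinearMap.BilinForm.dualBasis_repr_apply, sum_lie, smul_lie, lie_sum,
          lie_smul]

variable [Module.Finite K L]

/-- The Casimir endomorphism `∑ i, bᵢ bᵢ'` of the representation `V` attached to a nondegenerate
invariant form `Φ`, where `b` and `b'` are bases of `L` with `Φ bᵢ' bⱼ = δᵢⱼ`. -/
noncomputable def casimir (hΦ : Φ.Nondegenerate) (hinv : Φ.lieInvariant L) : V →ₗ⁅K,L⁆ V where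
  toLinearMap := ∑ i, toEnd K L V (finBasis K L i) ∘ₗ
    toEnd K L V (Φ.dualBasis hΦ (finBasis K L) i)
  map_lie' {x v} := by
    have invariance := sum_lie_lie_dualBasis V hΦ hinv (finBasis K L) x v
    simp only [AddHom.toFun_eq_coe, LinearMap.coe_toAddHom, LinearMap.sum_apply,
      LinearMap.comp_apply, toEnd_apply_apply, lie_sum, leibniz_lie x, lie_add,
      Finset.sum_add_distrib]
    rw [invariance, neg_add_cancel_left]

lemma coe_casimir (hΦ : Φ.Nondegenerate) (hinv : Φ.lieInvariant L) :
    (casimir V hΦ hinv : End K V) =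
      ∑ i, toEnd K L V (finBasis K L i) ∘ₗ toEnd K L V (Φ.dualBasis hΦ (finBasis K L) i) := rfl

lemma casimir_apply (hΦ : Φ.Nondegenerate) (hinv : Φ.lieInvariant L) (v : V) :
    casimir V hΦ hinv v =
      ∑ i, ⁅finBasis K L i, ⁅Φ.dualBasis hΦ (finBasis K L) i, v⁆⁆ := by
  simp [casimir]

variable {V} in
lemma maxTrivSubmodule_le_ker_casimir (hΦ : Φ.Nondegenerate) (hinv : Φ.lieInvariant L) :
    maxTrivSubmodule K L V ≤ (casimir V hΦ hinv).ker := fun v hv ↦ by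
  rw [mem_maxTrivSubmodule] at hv
  simp [casimir_apply, hv]

lemma trace_casimir (hΦ : (traceForm K L V).Nondegenerate) :
    LinearMap.trace K V (casimir V hΦ (traceForm_lieInvariant K L V) : End K V) =
      finrank K L := by
  simp only [coe_casimir, map_sum, ← traceForm_apply_apply, traceForm_comm K L V (finBasis K L _)]
  simp [LinearMap.BilinForm.apply_dualBasis_left]

end Casimir

section Eigen

variable {K L V : Type*} [Field K] [IsAlgClosed K] [AddCommGroup V] [Module K V] [Module.Finite K V]

lemma exists_hasEigenvalue_ne_zero_of_trace_ne_zero {f : End K V} (hf : LinearMap.trace K V f ≠ 0) :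
    ∃ μ ≠ 0, f.HasEigenvalue μ := by
  contrapose! hf
  rw [End.trace_eq_sum_roots_charpoly_of_splits (IsAlgClosed.splits _)]
  refine Multiset.sum_eq_zero fun μ hμ ↦ ?_
  by_contra hμ0
  exact hf μ hμ0
    ((End.hasEigenvalue_iff_isRoot_charpoly f μ).mpr (Polynomial.isRoot_of_mem_roots hμ))

variable [CharZero K] [LieRing L] [LieAlgebra K L] [LieRingModule L V] [LieModule K L V]
  [Module.Finite K L]

variable (K L V) in
theorem exists_lieSubmodule_disjoint_maxTrivSubmodule [Nontrivial L] [HasTrivialRadical K L]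
    [IsFaithful K L V] :
    ∃ J : LieSubmodule K L V, J ≠ ⊥ ∧ Disjoint J (maxTrivSubmodule K L V) := by
  have hΦ := traceForm_nondegenerate_of_hasTrivialRadical K L V
  let C : V →ₗ⁅K,L⁆ V := casimir V hΦ (traceForm_lieInvariant K L V)
  have trace_ne_zero : LinearMap.trace K V (C : End K V) ≠ 0 := by
    rw [trace_casimir]
    exact_mod_cast (finrank_pos (R := K) (M := L)).ne'
  obtain ⟨μ, hμ, eigen⟩ := exists_hasEigenvalue_ne_zero_of_trace_ne_zero trace_ne_zero
  have mem_ker {v : V} : v ∈ (C - μ • LieModuleHom.id).ker ↔ C v = μ • v := by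
    simp [sub_eq_zero]
  refine ⟨(C - μ • LieModuleHom.id).ker, fun h ↦ ?_, ?_⟩
  · obtain ⟨v, hv, hv0⟩ := eigen.exists_hasEigenvector
    have := mem_ker.mpr (End.mem_eigenspace_iff.mp hv)
    exact hv0 (by simpa [h] using this)
  · rw [disjoint_iff, LieSubmodule.eq_bot_iff]
    rintro v ⟨hv, hv0⟩
    have : C v = 0 := maxTrivSubmodule_le_ker_casimir hΦ _ hv0
    have smul_eq_zero' : μ • v = 0 := by rw [← mem_ker.mp hv, this]
    exact (smul_eq_zero.mp smul_eq_zero').resolve_left hμ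

end Eigen

section Faithful

variable {R L V : Type*} [CommRing R] [LieRing L] [LieAlgebra R L] [AddCommGroup V] [Module R V]
  [LieRingModule L V] [LieModule R L V]

lemma isFaithful_of_isFaithful_quotient (N : LieSubmodule R L V) [IsFaithful R L (V ⧸ N)] :
    IsFaithful R L V := by
  refine (isFaithful_iff' R L V).mpr fun x hx ↦ ext_of_isFaithful (R := R) (V ⧸ N) fun v ↦ ?_
  obtain ⟨v, rfl⟩ := LieSubmodule.Quotient.surjective_mk' N v
  rw [← LieModuleHom.map_lie, hx, map_zero, zero_lie]

end Faithful

section Isotropic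

variable {K L V : Type*} [Field K] [IsAlgClosed K] [CharZero K] [LieRing L] [LieAlgebra K L]
  [AddCommGroup V] [Module K V] [LieRingModule L V] [LieModule K L V] [Module.Finite K L]
  [Module.Finite K V] [Nontrivial L]

theorem exists_lieSubmodule_disjoint_maxTrivSubmodule_of_isotropic_le
    [IsFaithful K L (V ⧸ maxTrivSubmodule K L V)] (hcenter : center K L = ⊥)
    {Φ : LinearMap.BilinForm K V} (hrefl : Φ.IsRefl) (hinv : Φ.lieInvariant L)
    (hker : (maxTrivSubmodule K L V).toSubmodule ≤ LinearMap.ker Φ)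
    (hiso : ∀ I : LieSubmodule K L V, (∀ v ∈ I, ∀ w ∈ I, Φ v w = 0) → I ≤ maxTrivSubmodule K L V) :
    ∃ J : LieSubmodule K L V, J ≠ ⊥ ∧ Disjoint J (maxTrivSubmodule K L V) := by
  have : ComplementedLattice (LieSubmodule K L (V ⧸ maxTrivSubmodule K L V)) :=
    complementedLattice_quotient_of_isotropic_le hrefl hinv hker hiso
  have : HasCentralRadical K L :=
    hasCentralRadical_of_complementedLattice K L (V ⧸ maxTrivSubmodule K L V)
  have : HasTrivialRadical K L := ⟨by rw [HasCentralRadical.radical_eq_center, hcenter]⟩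
  have : IsFaithful K L V := isFaithful_of_isFaithful_quotient (maxTrivSubmodule K L V)
  exact exists_lieSubmodule_disjoint_maxTrivSubmodule K L V

end Isotropic

end LieModules

namespace NLieAlgebra

open LieModule Module

variable {n : ℕ} {g : Type*} [AddCommGroup g] [Module ℂ g] {L : NLieAlgebra n g}
  {I J : Submodule ℂ g}

section Ideals

variable (L) in
/-- The inner derivation `w ↦ [v₁, …, w, …, vₙ]` with `w` in slot `i`, overwriting `v i`. -/
def ad (v : Fin n → g) (i : Fin n) : End ℂ g :=
  L.bracket.toMultilinearMap.toLinearMap v i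

@[simp]
lemma ad_apply (v : Fin n → g) (i : Fin n) (w : g) :
    L.ad v i w = L.bracket (Function.update v i w) := rfl

lemma IsIdeal.ad_mem (hI : L.IsIdeal I) (v : Fin n → g) (i : Fin n) {x : g} (hx : x ∈ I) :
    L.ad v i x ∈ I :=
  hI _ i (by simpa using hx)

lemma isIdeal_of_ad_mem (h : ∀ v i, ∀ x ∈ I, L.ad v i x ∈ I) : L.IsIdeal I :=
  fun v i hv ↦ by simpa using h v i _ hv

lemma isIdeal_center : L.IsIdeal L.center :=
  isIdeal_of_ad_mem fun v i x hx ↦ by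
    rw [ad_apply, hx v i]
    exact zero_mem _

lemma IsIdeal.sup (hI : L.IsIdeal I) (hJ : L.IsIdeal J) : L.IsIdeal (I ⊔ J) := by
  refine isIdeal_of_ad_mem fun v i x hx ↦ ?_
  obtain ⟨a, ha, b, hb, rfl⟩ := Submodule.mem_sup.mp hx
  rw [map_add]
  exact Submodule.add_mem_sup (hI.ad_mem v i ha) (hJ.ad_mem v i hb)

lemma IsIdeal.inf (hI : L.IsIdeal I) (hJ : L.IsIdeal J) : L.IsIdeal (I ⊓ J) :=
  fun v i hv ↦ ⟨hI v i hv.1, hJ v i hv.2⟩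

lemma bracket_mem_bracketSpan {v : Fin n → g} (hv : ∀ i, v i ∈ I) :
    L.bracket v ∈ L.bracketSpan I :=
  Submodule.subset_span ⟨v, hv, rfl⟩

lemma bracketSpan_le_iff :
    L.bracketSpan I ≤ J ↔ ∀ v : Fin n → g, (∀ i, v i ∈ I) → L.bracket v ∈ J := by
  refine Submodule.span_le.trans ⟨fun h v hv ↦ h ⟨v, hv, rfl⟩, ?_⟩
  rintro h _ ⟨v, hv, rfl⟩
  exact h v hv

lemma IsIdeal.bracketSpan (hI : L.IsIdeal I) : L.IsIdeal (L.bracketSpan I) := by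
  refine isIdeal_of_ad_mem fun y j ↦ ?_
  refine bracketSpan_le_iff (J := (L.bracketSpan I).comap (L.ad y j)).mpr fun v hv ↦ ?_
  rw [Submodule.mem_comap, ad_apply, L.fundamental_identity]
  refine Submodule.sum_mem _ fun k _ ↦ bracket_mem_bracketSpan fun m ↦ ?_
  rcases eq_or_ne m k with rfl | hmk
  · simpa using hI.ad_mem y j (hv m)
  · simpa [hmk] using hv m

lemma IsIdeal.bracketSpan_le [NeZero n] (hI : L.IsIdeal I) : L.bracketSpan I ≤ I :=
  bracketSpan_le_iff.mpr fun v hv ↦ hI v 0 (hv 0)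

lemma isIdeal_derivedSeries_top (r : ℕ) : L.IsIdeal (L.derivedSeries ⊤ r) := by
  induction r with
  | zero => exact fun _ _ _ ↦ trivial
  | succ r ih => exact ih.bracketSpan

lemma antitone_derivedSeries_top [NeZero n] : Antitone (L.derivedSeries ⊤) :=
  antitone_nat_of_succ_le fun r ↦ (isIdeal_derivedSeries_top r).bracketSpan_le

variable (L) in
lemma exists_bracketSpan_derivedSeries_eq [NeZero n] [FiniteDimensional ℂ g] :
    ∃ r, L.bracketSpan (L.derivedSeries ⊤ r) = L.derivedSeries ⊤ r := by
  obtain ⟨r, hr⟩ := IsArtinian.monotone_stabilizes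
    (⟨fun r ↦ OrderDual.toDual (L.derivedSeries ⊤ r), antitone_derivedSeries_top⟩ :
      ℕ →o (Submodule ℂ g)ᵒᵈ)
  exact ⟨r, (hr (r + 1) r.le_succ).symm⟩

end Ideals

section Derivations

variable (L) in
/-- The Lie algebra of derivations of the `n`-ary bracket. -/
def derivations : LieSubalgebra ℂ (End ℂ g) where
  carrier := {f | ∀ v, f (L.bracket v) = ∑ i, L.bracket (Function.update v i (f (v i)))}
  zero_mem' v := by simp [L.bracket.map_update_zero]
  add_mem' hf hh v := by simp [hf v, hh v, L.bracket.map_update_add, Finset.sum_add_distrib]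
  smul_mem' c f hf v := by simp [hf v, L.bracket.map_update_smul, Finset.smul_sum]
  lie_mem' {f h} hf hh v := by
    have comp_apply {a c : End ℂ g}
        (ha : ∀ v, a (L.bracket v) = ∑ i, L.bracket (Function.update v i (a (v i))))
        (hc : ∀ v, c (L.bracket v) = ∑ i, L.bracket (Function.update v i (c (v i)))) :
        a (c (L.bracket v)) = ∑ i, ∑ j, L.bracket (Function.update
          (Function.update v i (c (v i))) j (a (Function.update v i (c (v i)) j))) := by
      simp only [hc, map_sum, ha]
    rw [Ring.lie_def, LinearMap.sub_apply, Module.End.mul_apply, Module.End.mul_apply,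
      comp_apply hf hh, comp_apply hh hf, Finset.sum_comm, ← Finset.sum_sub_distrib]
    refine Finset.sum_congr rfl fun i _ ↦ ?_
    rw [← Finset.sum_sub_distrib, Finset.sum_eq_single i]
    · simp [L.bracket.map_update_sub]
    · intro j _ hji
      rw [Function.update_of_ne hji, Function.update_of_ne hji.symm,
        Function.update_comm hji.symm, sub_self]
    · simp

variable (L) in
/-- The Lie algebra of endomorphisms of `g` generated by the inner derivations `ad v i`. -/
def innerDerivations : LieSubalgebra ℂ (End ℂ g) :=
  LieSubalgebra.lieSpan ℂ (End ℂ g) {f | ∃ v i, L.ad v i = f}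

lemma ad_mem_innerDerivations (v : Fin n → g) (i : Fin n) : L.ad v i ∈ L.innerDerivations :=
  LieSubalgebra.subset_lieSpan ⟨v, i, rfl⟩

lemma innerDerivations_le_derivations : L.innerDerivations ≤ L.derivations := by
  refine LieSubalgebra.lieSpan_le.mpr ?_
  rintro _ ⟨y, j, rfl⟩
  exact fun v ↦ L.fundamental_identity v y j

lemma IsIdeal.apply_mem (hI : L.IsIdeal I) {f : End ℂ g} (hf : f ∈ L.innerDerivations) {x : g}
    (hx : x ∈ I) : f x ∈ I := by
  induction hf using LieSubalgebra.lieSpan_induction generalizing x with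
  | mem f hf => obtain ⟨v, i, rfl⟩ := hf; exact hI.ad_mem v i hx
  | zero => exact I.zero_mem
  | add f h _ _ hf hh => exact I.add_mem (hf hx) (hh hx)
  | smul c f _ hf => exact I.smul_mem c (hf hx)
  | lie f h _ _ hf hh => exact I.sub_mem (hf (hh hx)) (hh (hf hx))

lemma apply_eq_zero_of_mem_center {f : End ℂ g} (hf : f ∈ L.innerDerivations) {z : g}
    (hz : z ∈ L.center) : f z = 0 := by
  induction hf using LieSubalgebra.lieSpan_induction with
  | mem f hf => obtain ⟨v, i, rfl⟩ := hf; exact hz v i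
  | zero => rfl
  | add f h _ _ hf hh => rw [LinearMap.add_apply, hf, hh, add_zero]
  | smul c f _ hf => rw [LinearMap.smul_apply, hf, smul_zero]
  | lie f h _ _ hf hh => simp [Ring.lie_def, hf, hh]

/-- An ideal as a module over the Lie algebra of inner derivations. -/
def IsIdeal.toLieSubmodule (hI : L.IsIdeal I) : LieSubmodule ℂ L.innerDerivations g where
  __ := I
  lie_mem {f _} hx := hI.apply_mem f.2 hx

end Derivations

section Perfect

variable {P : Submodule ℂ g}

lemma forall_mem_apply_eq_zero_of_perfect (hperf : L.bracketSpan P = P) {f : End ℂ g}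
    (hf : ∀ v : Fin n → g, (∀ i, v i ∈ P) → f (L.bracket v) = 0) : ∀ p ∈ P, f p = 0 :=
  hperf ▸ bracketSpan_le_iff (J := LinearMap.ker f).mpr hf

lemma eq_bot_of_perfect_of_le_center [NeZero n] (hperf : L.bracketSpan P = P)
    (hP : P ≤ L.center) : P = ⊥ := by
  rw [eq_bot_iff, ← hperf, bracketSpan_le_iff]
  intro v hv
  simpa using hP (hv 0) v 0

lemma forall_mem_apply_eq_zero_of_apply_mem_center (hperf : L.bracketSpan P = P) {f : End ℂ g}
    (hf : f ∈ L.derivations) (hcenter : ∀ p ∈ P, f p ∈ L.center) : ∀ p ∈ P, f p = 0 :=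
  forall_mem_apply_eq_zero_of_perfect hperf fun v hv ↦ by
    rw [hf v]
    exact Finset.sum_eq_zero fun i _ ↦ hcenter _ (hv i) v i

lemma forall_mem_apply_eq_zero_of_commute_ad (hn : n ≠ 1) (hperf : L.bracketSpan P = P)
    {f : End ℂ g} (hf : f ∈ L.derivations)
    (hcomm : ∀ v i, ∀ p ∈ P, f (L.ad v i p) = L.ad v i (f p)) : ∀ p ∈ P, f p = 0 :=
  forall_mem_apply_eq_zero_of_perfect hperf fun v hv ↦ by
    have bracket_update (i : Fin n) :
        L.bracket (Function.update v i (f (v i))) = f (L.bracket v) := by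
      simpa using (hcomm v i _ (hv i)).symm
    have eq_n_smul : f (L.bracket v) = (n : ℂ) • f (L.bracket v) := by
      conv_lhs => rw [hf v]
      simp [bracket_update, Nat.cast_smul_eq_nsmul]
    have n_ne_one : (n : ℂ) ≠ 1 := by exact_mod_cast hn
    by_contra hne
    exact n_ne_one (smul_left_injective ℂ hne (by simpa using eq_n_smul.symm))

end Perfect

section InnerAction

variable {P : LieSubmodule ℂ L.innerDerivations g}

variable (P) in
/-- The Lie algebra of endomorphisms of the ideal `P` induced by the inner derivations of the
ambient `n`-Lie algebra; unlike the inner derivations themselves it acts faithfully on `P`. -/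
def innerAction : LieSubalgebra ℂ (End ℂ P) :=
  (toEnd ℂ L.innerDerivations P).range

variable (P) in
/-- The endomorphism of `P` induced by `ad v i`. -/
def innerAd (v : Fin n → g) (i : Fin n) : innerAction P :=
  ⟨toEnd ℂ L.innerDerivations P ⟨L.ad v i, ad_mem_innerDerivations v i⟩, _, rfl⟩

@[simp]
lemma coe_innerAd_apply (v : Fin n → g) (i : Fin n) (p : P) :
    ((innerAd P v i : End ℂ P) p : g) = L.ad v i p := rfl

lemma exists_innerDerivation_of_innerAction (x : innerAction P) :
    ∃ f ∈ L.innerDerivations, ∀ p : P, ((x : End ℂ P) p : g) = f p := by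
  obtain ⟨_, f, rfl⟩ := x
  exact ⟨f, f.2, fun _ ↦ rfl⟩

lemma isIdeal_map_subtype (J : LieSubmodule ℂ (innerAction P) P) :
    L.IsIdeal (J.toSubmodule.map P.toSubmodule.subtype) := by
  refine isIdeal_of_ad_mem fun v i ↦ ?_
  rintro _ ⟨p, hp, rfl⟩
  exact ⟨_, J.lie_mem (x := innerAd P v i) hp, rfl⟩

lemma mem_maxTrivSubmodule_innerAction {p : P} :
    p ∈ maxTrivSubmodule ℂ (innerAction P) P ↔ (p : g) ∈ L.center := by
  rw [mem_maxTrivSubmodule]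
  refine ⟨fun h v i ↦ congrArg Subtype.val (h (innerAd P v i)), fun hp x ↦ ?_⟩
  obtain ⟨f, hf, hx⟩ := exists_innerDerivation_of_innerAction x
  exact Subtype.ext ((hx p).trans (apply_eq_zero_of_mem_center hf hp))

lemma nontrivial_innerAction [NeZero n] (hperf : L.bracketSpan P = P) (hP : P ≠ ⊥) :
    Nontrivial (innerAction P) := by
  contrapose! hP
  refine P.toSubmodule_eq_bot.mp (eq_bot_of_perfect_of_le_center hperf fun p hp v i ↦ ?_)
  have : innerAd P v i = 0 := Subsingleton.elim _ _
  simpa [this] using (coe_innerAd_apply v i ⟨p, hp⟩).symm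

lemma isFaithful_innerAction_quotient (hperf : L.bracketSpan P = P) :
    IsFaithful ℂ (innerAction P) (P ⧸ maxTrivSubmodule ℂ (innerAction P) P) := by
  refine (isFaithful_iff' _ _ _).mpr fun x hx ↦ ext_of_isFaithful (R := ℂ) P fun p ↦ ?_
  obtain ⟨f, hf, hxf⟩ := exists_innerDerivation_of_innerAction x
  have apply_mem_center : ∀ p ∈ P, f p ∈ L.center := fun p hp ↦ by
    rw [← hxf ⟨p, hp⟩, ← mem_maxTrivSubmodule_innerAction, ← LieSubmodule.Quotient.mk_eq_zero]
    exact hx (LieSubmodule.Quotient.mk ⟨p, hp⟩)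
  rw [zero_lie]
  exact Subtype.ext <| (hxf p).trans <| forall_mem_apply_eq_zero_of_apply_mem_center hperf
    (innerDerivations_le_derivations hf) apply_mem_center p p.2

lemma center_innerAction_eq_bot (hn : n ≠ 1) (hperf : L.bracketSpan P = P) :
    LieAlgebra.center ℂ (innerAction P) = ⊥ := by
  refine (LieSubmodule.eq_bot_iff _).mpr fun x hx ↦ ext_of_isFaithful (R := ℂ) P fun p ↦ ?_
  obtain ⟨f, hf, hxf⟩ := exists_innerDerivation_of_innerAction x
  have commute : ∀ v i, ∀ p ∈ P, f (L.ad v i p) = L.ad v i (f p) := fun v i p hp ↦ by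
    have lie_comm : ⁅x, ⁅innerAd P v i, (⟨p, hp⟩ : P)⁆⁆ = ⁅innerAd P v i, ⁅x, (⟨p, hp⟩ : P)⁆⁆ := by
      rw [leibniz_lie (innerAd P v i), (mem_maxTrivSubmodule _ _ _ _).mp hx, zero_lie, zero_add]
    simpa [hxf] using congrArg Subtype.val lie_comm
  rw [zero_lie]
  exact Subtype.ext <| (hxf p).trans <| forall_mem_apply_eq_zero_of_commute_ad hn hperf
    (innerDerivations_le_derivations hf) commute p p.2

end InnerAction

end NLieAlgebra

namespace MetricNLieAlgebra

variable {n : ℕ} {g : Type*} [AddCommGroup g] [Module ℂ g] {M : MetricNLieAlgebra n g}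
  {I J P : Submodule ℂ g}

open LieModule Module NLieAlgebra

lemma isRefl_B : M.B.IsRefl := fun x y h ↦ by rw [M.symm, h]

variable (M) in
lemma B_ad (v : Fin n → g) (i : Fin n) (x y : g) : M.B (M.ad v i x) y = -M.B x (M.ad v i y) := by
  rw [ad_apply, M.invariant, M.symm, ad_apply]

lemma B_apply_of_mem_innerDerivations {f : End ℂ g} (hf : f ∈ M.innerDerivations) (x y : g) :
    M.B (f x) y = -M.B x (f y) := by
  suffices M.innerDerivations ≤ skewAdjointLieSubalgebra M.B from
    (this hf x y).trans (by simp)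
  refine LieSubalgebra.lieSpan_le.mpr ?_
  rintro _ ⟨v, i, rfl⟩ x y
  simpa using M.B_ad v i x y

lemma restrict_B_lieInvariant (P : LieSubmodule ℂ M.innerDerivations g) :
    (M.B.restrict P.toSubmodule).lieInvariant (innerAction P) := fun x p q ↦ by
  obtain ⟨f, hf, hx⟩ := exists_innerDerivation_of_innerAction x
  simpa [hx] using B_apply_of_mem_innerDerivations hf p q

lemma isIdeal_orthogonal (hI : M.IsIdeal I) : M.IsIdeal (M.orthogonal I) :=
  isIdeal_of_ad_mem fun v i x hx w hw ↦ by
    have := M.B_ad v i w x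
    rwa [hx _ (hI.ad_mem v i hw), zero_eq_neg] at this

lemma le_orthogonal_center_of_perfect [NeZero n] (hperf : M.bracketSpan P = P) :
    P ≤ M.orthogonal M.center := by
  refine hperf.ge.trans (bracketSpan_le_iff.mpr fun v _ z hz ↦ ?_)
  have := M.B_ad v 0 z (v 0)
  rwa [ad_apply, hz v, map_zero, LinearMap.zero_apply, zero_eq_neg,
    ad_apply, Function.update_eq_self] at this

lemma le_center_of_isotropic (hiso : M.IsIsomaximal M.center) (hI : M.IsIdeal I)
    (hisoI : ∀ x ∈ I, ∀ y ∈ I, M.B x y = 0) (hIZ : I ≤ M.orthogonal M.center) : I ≤ M.center := by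
  have isotropic_sup : M.IsIsotropicIdeal (I ⊔ M.center) := by
    refine ⟨hI.sup isIdeal_center, fun x hx y hy ↦ ?_⟩
    obtain ⟨a, ha, c, hc, rfl⟩ := Submodule.mem_sup.mp hx
    obtain ⟨a', ha', c', hc', rfl⟩ := Submodule.mem_sup.mp hy
    have hc'a : M.B c' a = 0 := hIZ ha c' hc'
    have ha'c : M.B a' c = 0 := isRefl_B _ _ (hIZ ha' c hc)
    have hc'c : M.B c' c = 0 := hiso.prop.2 hc c' hc'
    simp [hisoI a' ha' a ha, hc'a, ha'c, hc'c]
  exact le_sup_left.trans (hiso.le_of_ge isotropic_sup le_sup_right)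

lemma eq_bot_or_eq_top_of_isNondegenerate [FiniteDimensional ℂ g] (hM : M.IsIndecomposable)
    (hJ : M.IsIdeal J) (hnd : M.IsNondegenerate J) : J = ⊥ ∨ J = ⊤ := by
  have compl : IsCompl J (M.orthogonal J) :=
    (LinearMap.BilinForm.isCompl_orthogonal_iff_disjoint isRefl_B).mpr (disjoint_iff.mpr hnd)
  by_contra! hne
  have orthogonal_ne_bot : M.orthogonal J ≠ ⊥ := fun h ↦ hne.2 (by simpa [h] using compl.sup_eq_top)
  refine hM ⟨J, M.orthogonal J, hJ, isIdeal_orthogonal hJ, hnd, ?_, hne.1, orthogonal_ne_bot, compl⟩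
  have : M.orthogonal (M.orthogonal J) = J := by
    refine LinearMap.BilinForm.orthogonal_orthogonal ?_ isRefl_B J
    exact isRefl_B.nondegenerate_iff_separatingLeft.mpr M.nondegenerate
  rw [IsNondegenerate, this, inf_comm]
  exact hnd

theorem exists_isIdeal_le_disjoint_center [FiniteDimensional ℂ g] (hn : 2 ≤ n)
    (hiso : M.IsIsomaximal M.center) {P : LieSubmodule ℂ M.innerDerivations g}
    (hperf : M.bracketSpan P = P) (hP : P ≠ ⊥) :
    ∃ J ≤ P.toSubmodule, M.IsIdeal J ∧ J ≠ ⊥ ∧ Disjoint J M.center := by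
  have : NeZero n := ⟨by lia⟩
  have P_le : P.toSubmodule ≤ M.orthogonal M.center := le_orthogonal_center_of_perfect hperf
  have := nontrivial_innerAction hperf hP
  have := isFaithful_innerAction_quotient hperf
  have isotropic_le (I : LieSubmodule ℂ (innerAction P) P)
      (hI : ∀ p ∈ I, ∀ q ∈ I, M.B.restrict P.toSubmodule p q = 0) :
      I ≤ maxTrivSubmodule ℂ (innerAction P) P := fun p hp ↦ by
    refine mem_maxTrivSubmodule_innerAction.mpr (le_center_of_isotropic hiso
      (isIdeal_map_subtype I) ?_ ((Submodule.map_subtype_le _ _).trans P_le)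
      (Submodule.mem_map_of_mem hp))
    rintro _ ⟨a, ha, rfl⟩ _ ⟨b, hb, rfl⟩
    exact hI a ha b hb
  obtain ⟨J, hJ, hJZ⟩ := exists_lieSubmodule_disjoint_maxTrivSubmodule_of_isotropic_le
    (K := ℂ) (L := innerAction P) (V := P) (Φ := M.B.restrict P.toSubmodule)
    (center_innerAction_eq_bot (by lia) hperf) (fun _ _ ↦ isRefl_B _ _) (restrict_B_lieInvariant P)
    (fun p hp ↦ LinearMap.ext fun q ↦ P_le q.2 p (mem_maxTrivSubmodule_innerAction.mp hp))
    isotropic_le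
  refine ⟨J.toSubmodule.map P.toSubmodule.subtype, Submodule.map_subtype_le _ _,
    isIdeal_map_subtype J, ?_, ?_⟩
  · rwa [Ne, ← LinearMap.le_ker_iff_map, Submodule.ker_subtype, le_bot_iff,
      J.toSubmodule_eq_bot]
  · rw [Submodule.disjoint_def]
    rintro _ ⟨p, hp, rfl⟩ hpZ
    rw [Submodule.disjoint_def.mp (LieSubmodule.disjoint_toSubmodule.mpr hJZ) p hp
      (mem_maxTrivSubmodule_innerAction.mpr hpZ), map_zero]

theorem eq_bot_of_perfect [FiniteDimensional ℂ g] (hn : 2 ≤ n) (hM : M.IsIndecomposable)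
    (hcenter : M.center ≠ ⊥) (hiso : M.IsIsomaximal M.center) (hP : M.IsIdeal P)
    (hperf : M.bracketSpan P = P) : P = ⊥ := by
  have : NeZero n := ⟨by lia⟩
  by_contra hPbot
  obtain ⟨J, hJP, hJ, hJbot, hJZ⟩ := exists_isIdeal_le_disjoint_center (P := hP.toLieSubmodule)
    hn hiso hperf fun h ↦ hPbot ((LieSubmodule.toSubmodule_eq_bot _).mpr h)
  have hJZ' : J ≤ M.orthogonal M.center := hJP.trans (le_orthogonal_center_of_perfect hperf)
  have radical_le_center : J ⊓ M.orthogonal J ≤ M.center :=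
    le_center_of_isotropic hiso (hJ.inf (isIdeal_orthogonal hJ)) (fun x hx y hy ↦ hy.2 x hx.1)
      (inf_le_left.trans hJZ')
  have nondegenerate : M.IsNondegenerate J :=
    eq_bot_iff.mpr (hJZ inf_le_left radical_le_center)
  obtain rfl | rfl := eq_bot_or_eq_top_of_isNondegenerate hM hJ nondegenerate
  · exact hJbot rfl
  · exact hcenter (top_disjoint.mp hJZ)

end MetricNLieAlgebra

theorem corollary3p5 {n : ℕ} (hn : 2 ≤ n) {g : Type*} [AddCommGroup g] [Module ℂ g]
    [FiniteDimensional ℂ g] (M : MetricNLieAlgebra n g) (hM : M.IsIndecomposable)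
    (hcenter : M.center ≠ ⊥) (hiso : M.IsIsomaximal M.center) :
    M.IsSolvable := by
  have : NeZero n := ⟨by lia⟩
  obtain ⟨r, hr⟩ := M.exists_bracketSpan_derivedSeries_eq
  exact ⟨fun _ _ _ ↦ trivial, r,
    MetricNLieAlgebra.eq_bot_of_perfect hn hM hcenter hiso (M.isIdeal_derivedSeries_top r) hr⟩
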